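/- For metric spaces $X$ and $Y$, a copy of $Y$ in $X$ is a subset of $X$ that is isometric to $Y$, and $\chi(X,Y)$ denotes the smallest number $c$ such that the points of $X$ can be coloured with $c$ colours without a monochromatic copy of $Y$. Let $\mathbb{R}^n_\infty$ be $\mathbb{R}^n$ with the metric $\|x-y\|_\infty=\max_i|x_i-y_i|$. For an integer $k\ge 1$ and a real $\lambda>0$, let $\mathcal{B}_k(\lambda)=\{0,\lambda,2\lambda,\dots,k\lambda\}\subset\mathbb{R}$ with the metric of $\mathbb{R}$, and equip a Cartesian product of metric spaces with the maximum of the metrics of the factors. Theorem. Let $k,m\ge 1$ be integers and let $\lambda_1,\dots,\lambda_m$ be positive reals. Then $\chi\big(\mathbb{R}^n_\infty,\mathcal{B}_k(\lambda_1)\times\dots\times\mathcal{B}_k(\lambda_m)\big)$ is finite for every $n$, and $$\chi\big(\mathbb{R}^n_\infty,\ \mathcal{B}_k(\lambda_1)\times\dots\times\mathcal{B}_k(\lambda_m)\big)=\left(\frac{k+1}{k}+o(1)\right)^n\qquad (n\to\infty),$$ where $k,m,\lambda_1,\dots,\lambda_m$ are fixed. -/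

import Mathlib

/-- `S` is a copy of the metric space `Y` in `X`: it is the image of a distance-preserving
bijection from `Y`. -/
def IsCopy (Y : Type*) {X : Type*} [MetricSpace X] [MetricSpace Y] (S : Set X) : Prop :=
  Nonempty (Y ≃ᵢ S)

/-- The colouring `f` of `X` has no monochromatic copy of `Y`. -/
def IsProperColouring (Y : Type*) {X C : Type*} [MetricSpace X] [MetricSpace Y]
    (f : X → C) : Prop :=
  ∀ S : Set X, IsCopy Y S → ¬ ∃ c : C, ∀ x ∈ S, f x = c

/-- The chromatic number `χ(X, Y)`: the least number of colours in a colouring of `X` without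
monochromatic copies of `Y`; it is `⊤` if no finite number of colours suffices. -/
noncomputable def chromaticNumber (X Y : Type*) [MetricSpace X] [MetricSpace Y] : ℕ∞ :=
  ⨅ (c : ℕ) (_ : ∃ f : X → Fin c, IsProperColouring Y f), (c : ℕ∞)

/-- The baton `{σ₀, …, σₖ} ⊆ ℝ`, where `σᵢ` is the sum of the first `i` terms of `lam`. -/
def baton {k : ℕ} (lam : Fin k → ℝ) : Set ℝ :=
  Set.range fun i : Fin (k + 1) => ∑ j : Fin k with j.val < i.val, lam j

/-- The baton with `k` equal gaps: the arithmetic progression `{0, lam, 2 * lam, …, k * lam}`. -/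
def arithBaton (k : ℕ) (lam : ℝ) : Set ℝ :=
  baton fun _ : Fin k => lam

/-! Both bounds equal `((k + 1) / k) ^ n` up to a factor polynomial in `n`, which disappears on
taking `n`-th roots.

Lower bound: pull a proper colouring back to words of length `n` over the grid `{0, …, k}ᵐ`. By
`card_le_of_not_isGridCopy`, a colour class is at most the fraction `(k / (k + 1)) ^ n * (n + 1) ^
m` of all words. The induction on `n` cuts the grid of first letters into lines in the direction of
the smallest step. On a line, either two neighbouring letters can be merged without creating copies,
or the whole line is present and supplies one factor of the product.

Upper bound: a greedy choice gives few words such that every word differs everywhere from one of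
them. Colour `x` by such a word for the residues mod `k + 1` of `⌊x j / lam i₀⌋`. Along a
monochromatic progression these floors never cross the forbidden residue, so its ends are too close.
-/

/-! ### Lower bound: copies in sets of grid words -/

/-- A point of the grid `{0, …, k}ᵐ` is sent to the corresponding combination of the steps. -/
def gridValue {k m : ℕ} (lam : Fin m → ℝ) (a : Fin m → Fin (k + 1)) : ℝ :=
  ∑ i, (a i : ℝ) * lam i

/-- `p` parametrises, up to `gridValue`, an isometric copy of the product of the batons with
steps `lam i`, `i ∈ S`, and this copy lies in `A`. -/
structure IsGridCopy {k m n : ℕ} (lam : Fin m → ℝ) (S : Finset (Fin m))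
    (A : Finset (Fin n → Fin m → Fin (k + 1)))
    (p : (Fin m → Fin (k + 1)) → Fin n → Fin m → Fin (k + 1)) : Prop where
  mem : ∀ j, p j ∈ A
  -- Equality of words, not only of values: `gridValue` need not be injective, and the lifts choose
  -- letters by word.
  congr : ∀ j j', (∀ i ∈ S, j i = j' i) → p j = p j'
  -- Quantifying over `r` avoids a maximum over a possibly empty `S`.
  le : ∀ j j' (r : ℝ), 0 ≤ r → (∀ i ∈ S, |(j i : ℝ) - j' i| * lam i ≤ r) →
    ∀ c, |gridValue lam (p j c) - gridValue lam (p j' c)| ≤ r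
  ge : ∀ j j', ∀ i ∈ S, ∃ c,
    |(j i : ℝ) - j' i| * lam i ≤ |gridValue lam (p j c) - gridValue lam (p j' c)|

/-- The grid point with `i`-th coordinate `t` and the other coordinates given by `b`. -/
def gridInsert {k m : ℕ} (i : Fin m) (b : {j // j ≠ i} → Fin (k + 1)) (t : Fin (k + 1)) :
    Fin m → Fin (k + 1) :=
  (Equiv.funSplitAt i (Fin (k + 1))).symm (t, b)

theorem gridValue_gridInsert_sub {k m : ℕ} (lam : Fin m → ℝ) (i : Fin m)
    (b : {j // j ≠ i} → Fin (k + 1)) (t t' : Fin (k + 1)) :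
    gridValue lam (gridInsert i b t) - gridValue lam (gridInsert i b t') =
      ((t : ℝ) - t') * lam i := by
  unfold gridValue
  rw [← Finset.sum_sub_distrib, Finset.sum_eq_single i]
  · simp [gridInsert, Equiv.funSplitAt, Equiv.piSplitAt]; ring
  · intro j _ hj
    simp [gridInsert, Equiv.funSplitAt, Equiv.piSplitAt, hj]
  · simp

/-- A proper subset of `{0, …, k}` meets at least as many pairs `{t, t + 1}` as it has elements. -/
theorem sum_le_sum_pair {k : ℕ} (C : Fin (k + 1) → Prop) [DecidablePred C] :
    (∑ t, if C t then 1 else 0) ≤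
      (∑ t : Fin k, if C t.castSucc ∨ C t.succ then 1 else 0) + if ∀ t, C t then 1 else 0 := by
  by_cases h : ∀ t, C t
  · simp [h]
  · rw [if_neg h, add_zero]
    push Not at h
    obtain ⟨s, hs⟩ := h
    -- Around the missing `s`, elements below it are charged to the pair they start, elements above
    -- it to the pair they end.
    rw [Fin.sum_univ_succAbove _ s, if_neg hs, zero_add]
    refine Finset.sum_le_sum fun t _ => ?_
    by_cases hC : C (s.succAbove t)
    · have : C t.castSucc ∨ C t.succ := by
        rcases lt_or_ge t.castSucc s with h | h
        · left; rwa [Fin.succAbove_of_castSucc_lt _ _ h] at hC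
        · right; rwa [Fin.succAbove_of_le_castSucc _ _ h] at hC
      rw [if_pos hC, if_pos this]
    · simp [hC]

/-- The points whose extension by the grid point `w` or by `w'` lies in `A`. -/
def mergedFibre {k m n : ℕ} (A : Finset (Fin (n + 1) → Fin m → Fin (k + 1)))
    (w w' : Fin m → Fin (k + 1)) : Finset (Fin n → Fin m → Fin (k + 1)) :=
  {y | (Fin.cons w y : Fin (n + 1) → Fin m → Fin (k + 1)) ∈ A ∨
    (Fin.cons w' y : Fin (n + 1) → Fin m → Fin (k + 1)) ∈ A}

/-- The points all of whose extensions along the line through `b` in direction `i` lie in `A`. -/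
def fullFibre {k m n : ℕ} (A : Finset (Fin (n + 1) → Fin m → Fin (k + 1))) (i : Fin m)
    (b : {j // j ≠ i} → Fin (k + 1)) : Finset (Fin n → Fin m → Fin (k + 1)) :=
  {y | ∀ t, (Fin.cons (gridInsert i b t) y : Fin (n + 1) → Fin m → Fin (k + 1)) ∈ A}

theorem card_le_sum_fibres {k m n : ℕ} (A : Finset (Fin (n + 1) → Fin m → Fin (k + 1)))
    (i : Fin m) :
    A.card ≤ (∑ b : {j // j ≠ i} → Fin (k + 1), ∑ t : Fin k,
        (mergedFibre A (gridInsert i b t.castSucc) (gridInsert i b t.succ)).card) +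
      ∑ b : {j // j ≠ i} → Fin (k + 1), (fullFibre A i b).card := by
  have hA : A.card = ∑ b : {j // j ≠ i} → Fin (k + 1), ∑ y : Fin n → Fin m → Fin (k + 1),
      ∑ t : Fin (k + 1),
      if (Fin.cons (gridInsert i b t) y : Fin (n + 1) → Fin m → Fin (k + 1)) ∈ A
        then 1 else 0 := by
    have h1 : A.card = ∑ x : Fin (n + 1) → Fin m → Fin (k + 1), if x ∈ A then 1 else 0 := by
      simp
    rw [h1, ← (Fin.consEquiv fun _ : Fin (n + 1) => Fin m → Fin (k + 1)).sum_comp,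
      Fintype.sum_prod_type, ← (Equiv.funSplitAt i (Fin (k + 1))).symm.sum_comp,
      Fintype.sum_prod_type, Finset.sum_comm]
    refine Finset.sum_congr rfl fun b _ => ?_
    rw [Finset.sum_comm]
    rfl
  rw [hA, ← Finset.sum_add_distrib]
  refine Finset.sum_le_sum fun b _ => ?_
  simp only [mergedFibre, fullFibre, Finset.card_filter]
  rw [Finset.sum_comm (s := (Finset.univ : Finset (Fin k))), ← Finset.sum_add_distrib]
  exact Finset.sum_le_sum fun y _ => sum_le_sum_pair _

/-- The new coordinate varies by at most `lam i`, the smallest step, hence by no more than the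
distance between any two distinct points of the copy. -/
theorem IsGridCopy.of_mergedFibre {k m n : ℕ} {lam : Fin m → ℝ} (hlam : ∀ i, 0 < lam i)
    {S : Finset (Fin m)} {i : Fin m} (hmin : ∀ i' ∈ S, lam i ≤ lam i')
    {A : Finset (Fin (n + 1) → Fin m → Fin (k + 1))} {b : {j // j ≠ i} → Fin (k + 1)} {t : Fin k}
    {p : (Fin m → Fin (k + 1)) → Fin n → Fin m → Fin (k + 1)}
    (hp : IsGridCopy lam S (mergedFibre A (gridInsert i b t.castSucc) (gridInsert i b t.succ)) p) :
    ∃ q, IsGridCopy lam S A q := by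
  classical
  have hlift : ∀ y : Fin n → Fin m → Fin (k + 1), ∃ s : Fin (k + 1),
      (s = t.castSucc ∨ s = t.succ) ∧
      (y ∈ mergedFibre A (gridInsert i b t.castSucc) (gridInsert i b t.succ) →
        (Fin.cons (gridInsert i b s) y : Fin (n + 1) → Fin m → Fin (k + 1)) ∈ A) := by
    intro y
    by_cases h : (Fin.cons (gridInsert i b t.castSucc) y :
        Fin (n + 1) → Fin m → Fin (k + 1)) ∈ A
    · exact ⟨_, Or.inl rfl, fun _ => h⟩
    · refine ⟨_, Or.inr rfl, fun hy => ?_⟩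
      simpa [mergedFibre, h] using hy
  choose s hs hsA using hlift
  have hs1 : ∀ y y', |(s y : ℝ) - s y'| ≤ 1 := by
    intro y y'
    rcases hs y with h | h <;> rcases hs y' with h' | h' <;> simp [h, h']
  refine ⟨fun j => Fin.cons (gridInsert i b (s (p j))) (p j), ?_, ?_, ?_, ?_⟩
  · exact fun j => hsA _ (hp.mem j)
  · intro j j' h
    simp only [hp.congr j j' h]
  · intro j j' r hr h c
    refine Fin.cases ?_ (fun c => ?_) c
    · simp only [Fin.cons_zero, gridValue_gridInsert_sub]
      by_cases hj : ∀ i ∈ S, j i = j' i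
      · simpa [hp.congr j j' hj] using hr
      · push Not at hj
        obtain ⟨i', hi', hne⟩ := hj
        have h1 : (1 : ℝ) ≤ |(j i' : ℝ) - j' i'| := by
          have : ((j i' : ℕ) : ℤ) - (j' i' : ℕ) ≠ 0 := by
            intro h0
            exact hne (Fin.ext (by omega))
          exact_mod_cast Int.one_le_abs this
        rw [abs_mul, abs_of_pos (hlam i)]
        calc |(s (p j) : ℝ) - s (p j')| * lam i ≤ 1 * lam i :=
              mul_le_mul_of_nonneg_right (hs1 _ _) (hlam i).le
          _ ≤ |(j i' : ℝ) - j' i'| * lam i' :=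
              mul_le_mul h1 (hmin i' hi') (hlam i).le (abs_nonneg _)
          _ ≤ r := h i' hi'
    · simpa using hp.le j j' r hr h c
  · intro j j' i' hi'
    obtain ⟨c, hc⟩ := hp.ge j j' i' hi'
    exact ⟨c.succ, by simpa using hc⟩

/-- The new coordinate runs through the full line and contributes the baton in direction `i`. -/
theorem IsGridCopy.of_fullFibre {k m n : ℕ} {lam : Fin m → ℝ} (hlam : ∀ i, 0 < lam i)
    {S : Finset (Fin m)} {i : Fin m} (hi : i ∈ S)
    {A : Finset (Fin (n + 1) → Fin m → Fin (k + 1))} {b : {j // j ≠ i} → Fin (k + 1)}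
    {p : (Fin m → Fin (k + 1)) → Fin n → Fin m → Fin (k + 1)}
    (hp : IsGridCopy lam (S.erase i) (fullFibre A i b) p) :
    ∃ q, IsGridCopy lam S A q := by
  refine ⟨fun j => Fin.cons (gridInsert i b (j i)) (p j), ?_, ?_, ?_, ?_⟩
  · intro j
    have := hp.mem j
    simp only [fullFibre, Finset.mem_filter, Finset.mem_univ, true_and] at this
    exact this (j i)
  · intro j j' h
    simp only [hp.congr j j' fun i' hi' => h i' (Finset.mem_of_mem_erase hi'), h i hi]
  · intro j j' r hr h c
    refine Fin.cases ?_ (fun c => ?_) c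
    · simpa [gridValue_gridInsert_sub, abs_mul, abs_of_pos (hlam i)] using h i hi
    · simpa using hp.le j j' r hr (fun i' hi' => h i' (Finset.mem_of_mem_erase hi')) c
  · intro j j' i' hi'
    by_cases h : i' = i
    · subst h
      exact ⟨0, by simp [gridValue_gridInsert_sub, abs_mul, abs_of_pos (hlam i')]⟩
    · obtain ⟨c, hc⟩ := hp.ge j j' i' (Finset.mem_erase.2 ⟨h, hi'⟩)
      exact ⟨c.succ, by simpa using hc⟩

/-- A set of grid points without a copy of the product of the batons indexed by `S` is small. -/
theorem card_le_of_not_isGridCopy {k m : ℕ} (hk : 1 ≤ k) {lam : Fin m → ℝ}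
    (hlam : ∀ i, 0 < lam i) (n : ℕ) : ∀ (s : ℕ) (S : Finset (Fin m)), S.card = s →
    ∀ A : Finset (Fin n → Fin m → Fin (k + 1)), (¬ ∃ p, IsGridCopy lam S A p) →
      A.card ≤ (k * (k + 1) ^ (m - 1)) ^ n * (n + 1) ^ s := by
  induction n with
  | zero =>
    intro s S _ A _
    simpa using Finset.card_le_univ A
  | succ n ih =>
    intro s S hS A hA
    -- For empty `S` the product is a point, so any word gives a copy.
    rcases S.eq_empty_or_nonempty with rfl | hne
    · rcases A.eq_empty_or_nonempty with rfl | ⟨x, hx⟩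
      · simp
      · refine absurd ⟨fun _ => x, fun _ => hx, fun _ _ _ => rfl, ?_, ?_⟩ hA
        · intro _ _ r hr _ _
          simpa using hr
        · simp
    obtain ⟨i, hi, hmin⟩ := S.exists_min_image lam hne
    obtain ⟨s, rfl⟩ : ∃ s', s = s' + 1 :=
      ⟨s - 1, by have := hne.card_pos; omega⟩
    have hL : Fintype.card ({j // j ≠ i} → Fin (k + 1)) = (k + 1) ^ (m - 1) := by simp
    set L := (k + 1) ^ (m - 1) with hLdef
    have h1 : ∀ (b : {j // j ≠ i} → Fin (k + 1)) (t : Fin k),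
        (mergedFibre A (gridInsert i b t.castSucc) (gridInsert i b t.succ)).card ≤
          (k * L) ^ n * (n + 1) ^ (s + 1) := fun b t =>
      ih _ S hS _ fun ⟨_, hp⟩ => hA (hp.of_mergedFibre hlam hmin)
    have h2 : ∀ b : {j // j ≠ i} → Fin (k + 1),
        (fullFibre A i b).card ≤ (k * L) ^ n * (n + 1) ^ s := fun b =>
      ih _ (S.erase i) (by rw [Finset.card_erase_of_mem hi, hS]; rfl) _
        fun ⟨_, hp⟩ => hA (hp.of_fullFibre hlam hi)
    calc A.card ≤ _ := card_le_sum_fibres A i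
      _ ≤ (∑ _b : {j // j ≠ i} → Fin (k + 1), ∑ _t : Fin k,
            (k * L) ^ n * (n + 1) ^ (s + 1)) +
          ∑ _b : {j // j ≠ i} → Fin (k + 1), (k * L) ^ n * (n + 1) ^ s :=
        add_le_add (Finset.sum_le_sum fun b _ => Finset.sum_le_sum fun t _ => h1 b t)
          (Finset.sum_le_sum fun b _ => h2 b)
      _ = (k * L) ^ (n + 1) * (n + 1) ^ (s + 1) + L * ((k * L) ^ n * (n + 1) ^ s) := by
        simp only [Finset.sum_const, Finset.card_univ, hL, Fintype.card_fin, smul_eq_mul]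
        ring
      _ ≤ (k * L) ^ (n + 1) * (n + 1) ^ (s + 1) + (k * L) * ((k * L) ^ n * (n + 1) ^ s) := by
        gcongr
        exact Nat.le_mul_of_pos_left _ hk
      _ = (k * L) ^ (n + 1) * ((n + 1) ^ s * (n + 1 + 1)) := by ring
      _ ≤ (k * L) ^ (n + 1) * ((n + 1 + 1) ^ s * (n + 1 + 1)) := by
        gcongr
        omega
      _ = (k * L) ^ (n + 1) * (n + 1 + 1) ^ (s + 1) := by ring

theorem mem_arithBaton_iff {k : ℕ} {l x : ℝ} :
    x ∈ arithBaton k l ↔ ∃ t : Fin (k + 1), (t : ℝ) * l = x := by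
  have h : ∀ t : Fin (k + 1), ({j : Fin k | j.val < t.val} : Finset (Fin k)).card = t.val := by
    intro t
    rw [Fin.card_filter_val_lt]
    omega
  simp [arithBaton, baton, h]

/-- A grid copy of the full product yields an isometric copy of the product of batons. -/
theorem IsGridCopy.isCopy_range {k m n : ℕ} {lam : Fin m → ℝ} (hlam : ∀ i, 0 < lam i)
    {A : Finset (Fin n → Fin m → Fin (k + 1))}
    {p : (Fin m → Fin (k + 1)) → Fin n → Fin m → Fin (k + 1)}
    (hp : IsGridCopy lam Finset.univ A p) :
    ∃ S : Set (Fin n → ℝ), IsCopy ((i : Fin m) → arithBaton k (lam i)) S ∧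
      ∀ x ∈ S, ∃ a ∈ A, x = fun c => gridValue lam (a c) := by
  choose t ht using fun (i : Fin m) (y : arithBaton k (lam i)) => mem_arithBaton_iff.1 y.2
  have hdist : ∀ (y y' : (i : Fin m) → arithBaton k (lam i)) (i : Fin m),
      dist (y i) (y' i) = |(t i (y i) : ℝ) - t i (y' i)| * lam i := by
    intro y y' i
    rw [Subtype.dist_eq, ← ht i (y i), ← ht i (y' i), Real.dist_eq, ← sub_mul, abs_mul,
      abs_of_pos (hlam i)]
  set g : ((i : Fin m) → arithBaton k (lam i)) → Fin n → ℝ :=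
    fun y c => gridValue lam (p (fun i => t i (y i)) c) with hg
  have hiso : Isometry g := by
    refine Isometry.of_dist_eq fun y y' => le_antisymm ?_ ?_
    · refine (dist_pi_le_iff dist_nonneg).2 fun c => ?_
      rw [Real.dist_eq]
      refine hp.le _ _ _ dist_nonneg (fun i _ => ?_) c
      rw [← hdist]
      exact dist_le_pi_dist y y' i
    · refine (dist_pi_le_iff dist_nonneg).2 fun i => ?_
      obtain ⟨c, hc⟩ := hp.ge (fun i => t i (y i)) (fun i => t i (y' i)) i (Finset.mem_univ i)
      rw [hdist]
      refine hc.trans ?_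
      have := dist_le_pi_dist (g y) (g y') c
      rwa [Real.dist_eq] at this
  refine ⟨Set.range g, ⟨hiso.isometryEquivOnRange⟩, ?_⟩
  rintro _ ⟨y, rfl⟩
  exact ⟨_, hp.mem _, rfl⟩

/-- Every proper colouring uses many colours. -/
theorem pow_le_mul_of_isProperColouring {k m n c : ℕ} (hk : 1 ≤ k) (hm : 1 ≤ m)
    {lam : Fin m → ℝ} (hlam : ∀ i, 0 < lam i) {f : (Fin n → ℝ) → Fin c}
    (hf : IsProperColouring ((i : Fin m) → arithBaton k (lam i)) f) :
    (k + 1) ^ n ≤ c * (k ^ n * (n + 1) ^ m) := by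
  classical
  set L := (k + 1) ^ (m - 1) with hL
  have hLpos : 0 < L := by positivity
  have hclass : ∀ col : Fin c, (Finset.univ.filter fun x : Fin n → Fin m → Fin (k + 1) =>
      f (fun j => gridValue lam (x j)) = col).card ≤ (k * L) ^ n * (n + 1) ^ m := by
    intro col
    refine card_le_of_not_isGridCopy hk hlam n m Finset.univ (by simp) _ ?_
    rintro ⟨p, hp⟩
    obtain ⟨S, hS, hSA⟩ := hp.isCopy_range hlam
    refine hf S hS ⟨col, fun x hx => ?_⟩
    obtain ⟨a, ha, rfl⟩ := hSA x hx
    exact (Finset.mem_filter.1 ha).2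
  have hcard : ((k + 1) * L) ^ n ≤ c * ((k * L) ^ n * (n + 1) ^ m) := by
    calc ((k + 1) * L) ^ n = (Finset.univ : Finset (Fin n → Fin m → Fin (k + 1))).card := by
          rw [hL, ← pow_succ', Nat.sub_add_cancel hm]
          simp
      _ = ∑ col : Fin c, (Finset.univ.filter fun x : Fin n → Fin m → Fin (k + 1) =>
            f (fun j => gridValue lam (x j)) = col).card :=
          Finset.card_eq_sum_card_fiberwise fun _ _ => Finset.mem_coe.2 (Finset.mem_univ _)
      _ ≤ ∑ _col : Fin c, (k * L) ^ n * (n + 1) ^ m := Finset.sum_le_sum fun col _ => hclass col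
      _ = _ := by simp
  -- The directions other than the cut one contribute `L ^ n` to both sides.
  refine Nat.le_of_mul_le_mul_right ?_ (pow_pos hLpos n)
  calc (k + 1) ^ n * L ^ n = ((k + 1) * L) ^ n := (mul_pow _ _ _).symm
    _ ≤ _ := hcard
    _ = _ := by rw [mul_pow]; ring

/-! ### Upper bound: covering words by greedy choice -/

/-- Greedy covering: if every point is missed by at most `b` of the sets, `s` of the sets
leave at most the proportion `(b / |U|) ^ s` of the points uncovered. -/
theorem exists_greedy_cover {P U : Type*} [Fintype P] [Fintype U] [Nonempty U]
    (R : P → U → Prop) (b : ℕ) [∀ p, DecidablePred (R p)] [∀ u, DecidablePred fun p => R p u]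
    (hb : ∀ p, (Finset.univ.filter fun u => ¬ R p u).card ≤ b) (s : ℕ) :
    ∃ T : Fin s → U, ∃ V : Finset P, (∀ p, p ∉ V → ∃ i, R p (T i)) ∧
      V.card * Fintype.card U ^ s ≤ Fintype.card P * b ^ s := by
  induction s with
  | zero => exact ⟨Fin.elim0, Finset.univ, by simp, by simp⟩
  | succ s ih =>
    obtain ⟨T, V, hT, hV⟩ := ih
    have hsum : ∑ u : U, (V.filter fun p => ¬ R p u).card ≤ V.card * b := by
      simp only [Finset.card_filter]
      rw [Finset.sum_comm, ← smul_eq_mul]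
      refine Finset.sum_le_card_nsmul _ _ _ fun p _ => ?_
      rw [← Finset.card_filter]
      exact hb p
    -- Some `u` does at least as well as the average.
    obtain ⟨u, hu⟩ : ∃ u : U,
        Fintype.card U * (V.filter fun p => ¬ R p u).card ≤ V.card * b := by
      by_contra! h
      have h1 : ∑ _u : U, V.card * b <
          ∑ u : U, Fintype.card U * (V.filter fun p => ¬ R p u).card :=
        Finset.sum_lt_sum_of_nonempty Finset.univ_nonempty fun u _ => h u
      rw [Finset.sum_const, smul_eq_mul, Finset.card_univ, ← Finset.mul_sum] at h1
      exact absurd (Nat.lt_of_mul_lt_mul_left h1) (not_lt.2 hsum)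
    refine ⟨Fin.cons u T, V.filter fun p => ¬ R p u, ?_, ?_⟩
    · intro p hp
      by_cases hpV : p ∈ V
      · refine ⟨0, ?_⟩
        simpa [hpV] using hp
      · obtain ⟨i, hi⟩ := hT p hpV
        exact ⟨i.succ, by simpa using hi⟩
    · calc _ = (Fintype.card U * (V.filter fun p => ¬ R p u).card) * Fintype.card U ^ s := by
            ring
        _ ≤ V.card * b * Fintype.card U ^ s := by gcongr
        _ = V.card * Fintype.card U ^ s * b := by ring
        _ ≤ Fintype.card P * b ^ s * b := by gcongr
        _ = _ := by ring

/-- Few words over an alphabet of `k + 1` letters suffice for every word to differ in all places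
from one of them. -/
theorem exists_avoiding_family {k : ℕ} (hk : 1 ≤ k) (n : ℕ) :
    ∃ s : ℕ, (s : ℝ) ≤ (((k : ℝ) + 1) / k) ^ n * (n + 1) ^ k ∧
      ∃ T : Fin s → Fin n → Fin (k + 1), ∀ z : Fin n → Fin (k + 1), ∃ i, ∀ j, z j ≠ T i j := by
  classical
  have hk0 : (0 : ℝ) < k := by exact_mod_cast hk
  set r : ℝ := ((k : ℝ) + 1) / k with hr
  have hr1 : 1 ≤ r := by rw [hr, le_div_iff₀ hk0]; linarith
  have hrn : 1 ≤ r ^ n := one_le_pow₀ hr1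
  -- Large enough that `(k + 1) ^ n * exp (-s / r ^ n) < 1`; the `+ 1` makes this strict.
  set s : ℕ := ⌊r ^ n * (n * Real.log (k + 1))⌋₊ + 1 with hs
  have hlog0 : 0 ≤ Real.log ((k : ℝ) + 1) := Real.log_nonneg (by linarith)
  refine ⟨s, ?_, ?_⟩
  · have hlog : Real.log ((k : ℝ) + 1) ≤ k := by
      have := Real.log_le_sub_one_of_pos (show (0 : ℝ) < (k : ℝ) + 1 by linarith)
      linarith
    calc (s : ℝ) ≤ r ^ n * (n * Real.log (k + 1)) + 1 := by
          rw [hs]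
          push_cast
          gcongr
          exact Nat.floor_le (by positivity)
      _ ≤ r ^ n * (n * k) + r ^ n := by gcongr
      _ = r ^ n * (1 + k * n) := by ring
      _ ≤ r ^ n * (1 + n) ^ k := by
          gcongr
          exact one_add_mul_le_pow (by have : (0 : ℝ) ≤ n := n.cast_nonneg
                                       linarith) k
      _ = r ^ n * (n + 1) ^ k := by rw [add_comm (1 : ℝ)]
  · have hcard : Fintype.card (Fin n → Fin (k + 1)) = (k + 1) ^ n := by simp
    have hle : k ^ n ≤ (k + 1) ^ n := Nat.pow_le_pow_left (Nat.le_succ k) n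
    obtain ⟨T, V, hT, hV⟩ := exists_greedy_cover
      (fun z u : Fin n → Fin (k + 1) => ∀ j, z j ≠ u j) ((k + 1) ^ n - k ^ n) (fun z => by
        have h1 : (Finset.univ.filter fun u : Fin n → Fin (k + 1) => ∀ j, z j ≠ u j).card =
            k ^ n := by
          have : (Finset.univ.filter fun u : Fin n → Fin (k + 1) => ∀ j, z j ≠ u j) =
              Fintype.piFinset fun j => Finset.univ.erase (z j) := by
            ext u
            simp [Fintype.mem_piFinset, eq_comm]
          rw [this, Fintype.card_piFinset]
          simp
        have h2 := Finset.card_filter_add_card_filter_not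
          (s := (Finset.univ : Finset (Fin n → Fin (k + 1)))) (fun u => ∀ j, z j ≠ u j)
        rw [h1, Finset.card_univ, hcard] at h2
        omega) s
    refine ⟨T, fun z => hT z ?_⟩
    suffices V = ∅ by simp [this]
    rw [hcard] at hV
    have hN : (0 : ℝ) < ((k : ℝ) + 1) ^ n := by positivity
    have hV' : (V.card : ℝ) * (((k : ℝ) + 1) ^ n) ^ s ≤
        ((k : ℝ) + 1) ^ n * (((k : ℝ) + 1) ^ n - (k : ℝ) ^ n) ^ s := by
      have h3 : ((V.card * ((k + 1) ^ n) ^ s : ℕ) : ℝ) ≤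
          (((k + 1) ^ n * ((k + 1) ^ n - k ^ n) ^ s : ℕ) : ℝ) := Nat.cast_le.2 hV
      push_cast [Nat.cast_sub hle] at h3
      exact h3
    have hfrac : ((k : ℝ) + 1) ^ n - (k : ℝ) ^ n = ((k : ℝ) + 1) ^ n * (1 - (r ^ n)⁻¹) := by
      rw [hr, div_pow, inv_div]
      field_simp
    rw [hfrac, mul_pow, mul_left_comm, mul_comm (V.card : ℝ)] at hV'
    have hV2 : (V.card : ℝ) ≤ ((k : ℝ) + 1) ^ n * (1 - (r ^ n)⁻¹) ^ s :=
      le_of_mul_le_mul_left hV' (by positivity)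
    have hinv : (r ^ n)⁻¹ ≤ 1 := inv_le_one_of_one_le₀ hrn
    have hexp : (1 - (r ^ n)⁻¹) ^ s ≤ Real.exp (-(s * (r ^ n)⁻¹)) := by
      rw [← mul_neg, Real.exp_nat_mul]
      exact pow_le_pow_left₀ (by linarith) (Real.one_sub_le_exp_neg _) s
    have hslt : n * Real.log ((k : ℝ) + 1) < s * (r ^ n)⁻¹ := by
      rw [← div_eq_mul_inv, lt_div_iff₀ (by positivity), mul_comm, hs]
      exact_mod_cast Nat.lt_floor_add_one _
    have hV3 : (V.card : ℝ) < 1 := by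
      calc (V.card : ℝ) ≤ ((k : ℝ) + 1) ^ n * Real.exp (-(s * (r ^ n)⁻¹)) :=
            hV2.trans (by gcongr)
        _ = Real.exp (n * Real.log ((k : ℝ) + 1) - s * (r ^ n)⁻¹) := by
            rw [sub_eq_add_neg, Real.exp_add, Real.exp_nat_mul, Real.exp_log (by positivity)]
        _ < 1 := Real.exp_lt_one_iff.2 (by linarith)
    have : V.card < 1 := by exact_mod_cast hV3
    exact Finset.card_eq_zero.1 (by omega)

/-! ### Upper bound: colouring by residues -/

/-- Integers at distance at most one, neither divisible by `d`, have the same quotient by `d`. -/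
theorem ediv_eq_of_not_dvd {d a b : ℤ} (hd : 0 < d) (ha : ¬ d ∣ a) (hb : ¬ d ∣ b)
    (h1 : a ≤ b + 1) (h2 : b ≤ a + 1) : a / d = b / d := by
  have key : ∀ x y : ℤ, ¬ d ∣ y → y ≤ x + 1 → y / d ≤ x / d := by
    intro x y hy h
    rw [Int.le_ediv_iff_mul_le hd]
    have h3 := Int.emod_add_mul_ediv y d
    have h4 : 0 < y % d :=
      lt_of_le_of_ne (Int.emod_nonneg y hd.ne') fun h0 => hy (Int.dvd_of_emod_eq_zero h0.symm)
    rw [mul_comm]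
    omega
  exact le_antisymm (key _ _ ha h1) (key _ _ hb h2)

/-- A walk on the integers with steps at most one which avoids a residue class modulo `k + 1`
stays within distance `k - 1` of its start. -/
theorem abs_sub_lt_of_avoids_residue {k : ℕ} (q : ℕ → ℤ) (u : ℤ)
    (hu : ∀ a ≤ k, ¬ ((k : ℤ) + 1) ∣ q a - u)
    (hstep : ∀ a < k, q a ≤ q (a + 1) + 1 ∧ q (a + 1) ≤ q a + 1) :
    |q k - q 0| < k := by
  have hd : (0 : ℤ) < (k : ℤ) + 1 := by positivity
  -- The walk stays strictly between two consecutive multiples of `k + 1`, where only `k` integers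
  -- lie.
  have hdiv : ∀ a ≤ k, (q a - u) / ((k : ℤ) + 1) = (q 0 - u) / ((k : ℤ) + 1) := by
    intro a
    induction a with
    | zero => simp
    | succ a ih =>
      intro ha
      rw [← ih (by omega)]
      have := hstep a (by omega)
      exact ediv_eq_of_not_dvd hd (hu _ ha) (hu _ (by omega)) (by omega) (by omega)
  have key : ∀ a ≤ k, 0 < (q a - u) % ((k : ℤ) + 1) ∧ (q a - u) % ((k : ℤ) + 1) < (k : ℤ) + 1 :=
    fun a ha => ⟨lt_of_le_of_ne (Int.emod_nonneg _ hd.ne')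
      fun h0 => hu a ha (Int.dvd_of_emod_eq_zero h0.symm), Int.emod_lt_of_pos _ hd⟩
  have e0 := Int.emod_add_mul_ediv (q 0 - u) ((k : ℤ) + 1)
  have ek := Int.emod_add_mul_ediv (q k - u) ((k : ℤ) + 1)
  rw [hdiv k le_rfl] at ek
  have k0 := key 0 (Nat.zero_le k)
  have kk := key k le_rfl
  rw [abs_lt]
  constructor <;> omega

/-- The residue of `⌊x⌋` modulo `k + 1`. -/
noncomputable def floorResidue (k : ℕ) (x : ℝ) : Fin (k + 1) :=
  ⟨(⌊x⌋ % ((k : ℤ) + 1)).toNat, by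
    have h1 := Int.emod_lt_of_pos ⌊x⌋ (show (0 : ℤ) < (k : ℤ) + 1 by positivity)
    have h2 := Int.emod_nonneg ⌊x⌋ (show (k : ℤ) + 1 ≠ 0 by positivity)
    omega⟩

theorem not_dvd_of_floorResidue_ne {k : ℕ} {x : ℝ} {u : Fin (k + 1)}
    (h : floorResidue k x ≠ u) : ¬ ((k : ℤ) + 1) ∣ ⌊x⌋ - (u : ℕ) := by
  intro hdvd
  refine h (Fin.ext ?_)
  have h1 : ⌊x⌋ % ((k : ℤ) + 1) = ((u : ℕ) : ℤ) % ((k : ℤ) + 1) :=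
    Int.emod_eq_emod_iff_emod_sub_eq_zero.2 (Int.emod_eq_zero_of_dvd hdvd)
  have h2 : ((u : ℕ) : ℤ) % ((k : ℤ) + 1) = (u : ℕ) :=
    Int.emod_eq_of_lt (by positivity) (by have := u.2; omega)
  simp only [floorResidue, h1, h2, Int.toNat_natCast]

theorem floor_div_le_add_one {x y l : ℝ} (hl : 0 < l) (h : |x - y| ≤ l) :
    ⌊x / l⌋ ≤ ⌊y / l⌋ + 1 := by
  have h1 : x / l ≤ y / l + 1 := by
    rw [div_add_one hl.ne', div_le_div_iff_of_pos_right hl]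
    linarith [(abs_le.1 h).2]
  exact (Int.floor_mono h1).trans (by rw [Int.floor_add_one])

/-- A colour class all of whose points avoid a fixed residue in each coordinate contains no
progression of `k + 1` points with step `l`. -/
theorem not_progression_of_avoids_residue {k n : ℕ} (hk : 1 ≤ k) {l : ℝ} (hl : 0 < l)
    (p : ℕ → Fin n → ℝ) (u : Fin n → Fin (k + 1))
    (hu : ∀ a ≤ k, ∀ j, floorResidue k (p a j / l) ≠ u j)
    (hstep : ∀ a < k, dist (p a) (p (a + 1)) ≤ l) : dist (p k) (p 0) < k * l := by
  have hk0 : (0 : ℝ) < k := by exact_mod_cast hk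
  refine (dist_pi_lt_iff (by positivity)).2 fun j => ?_
  have hq := abs_sub_lt_of_avoids_residue (k := k) (fun a => ⌊p a j / l⌋) (u j : ℕ)
    (fun a ha => not_dvd_of_floorResidue_ne (hu a ha j)) (fun a ha => by
      have h := (dist_le_pi_dist (p a) (p (a + 1)) j).trans (hstep a ha)
      rw [Real.dist_eq] at h
      exact ⟨floor_div_le_add_one hl h, floor_div_le_add_one hl (by rwa [abs_sub_comm])⟩)
  rw [abs_lt] at hq
  have h1 : (⌊p k j / l⌋ : ℝ) - ⌊p 0 j / l⌋ ≤ k - 1 := by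
    have : ⌊p k j / l⌋ - ⌊p 0 j / l⌋ ≤ (k : ℤ) - 1 := by omega
    exact_mod_cast this
  have h2 : (⌊p 0 j / l⌋ : ℝ) - ⌊p k j / l⌋ ≤ k - 1 := by
    have : ⌊p 0 j / l⌋ - ⌊p k j / l⌋ ≤ (k : ℤ) - 1 := by omega
    exact_mod_cast this
  have a1 := Int.floor_le (p k j / l)
  have a2 := Int.lt_floor_add_one (p k j / l)
  have b1 := Int.floor_le (p 0 j / l)
  have b2 := Int.lt_floor_add_one (p 0 j / l)
  have h3 : |p k j / l - p 0 j / l| < k := by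
    rw [abs_lt]
    constructor <;> linarith
  rwa [← sub_div, abs_div, abs_of_pos hl, div_lt_iff₀ hl] at h3

/-- There is a proper colouring with few colours. -/
theorem exists_isProperColouring {k m : ℕ} (hk : 1 ≤ k) (hm : 1 ≤ m) {lam : Fin m → ℝ}
    (hlam : ∀ i, 0 < lam i) (n : ℕ) :
    ∃ s : ℕ, (s : ℝ) ≤ (((k : ℝ) + 1) / k) ^ n * (n + 1) ^ k ∧
      ∃ f : (Fin n → ℝ) → Fin s,
        IsProperColouring ((i : Fin m) → arithBaton k (lam i)) f := by
  obtain ⟨s, hs, T, hT⟩ := exists_avoiding_family hk n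
  -- One factor suffices: the product contains its baton, with all other coordinates `0`.
  set i₀ : Fin m := ⟨0, hm⟩
  choose f hf using fun x : Fin n → ℝ => hT fun j => floorResidue k (x j / lam i₀)
  refine ⟨s, hs, f, ?_⟩
  rintro S ⟨e⟩ ⟨col, hcol⟩
  have hmem : ∀ (a : ℕ) (i : Fin m), (if a ≤ k ∧ i = i₀ then (a : ℝ) * lam i else 0) ∈
      arithBaton k (lam i) := by
    intro a i
    rw [mem_arithBaton_iff]
    split_ifs with h
    · exact ⟨⟨a, by omega⟩, rfl⟩
    · exact ⟨0, by simp⟩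
  set y : ℕ → (i : Fin m) → arithBaton k (lam i) := fun a i => ⟨_, hmem a i⟩ with hy
  have hdist : ∀ a ≤ k, ∀ b ≤ k, dist (y a) (y b) = |(a : ℝ) - b| * lam i₀ := by
    intro a ha b hb
    have hi₀ : dist (y a i₀) (y b i₀) = |(a : ℝ) - b| * lam i₀ := by
      rw [Subtype.dist_eq, Real.dist_eq]
      simp only [hy, ha, hb, and_self, if_true]
      rw [← sub_mul, abs_mul, abs_of_pos (hlam i₀)]
    refine le_antisymm ((dist_pi_le_iff (by have := hlam i₀; positivity)).2 fun i => ?_) ?_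
    · by_cases hi : i = i₀
      · rw [hi, hi₀]
      · have : y a i = y b i := Subtype.ext (by simp [hy, hi])
        rw [this, dist_self]
        have := hlam i₀
        positivity
    · rw [← hi₀]
      exact dist_le_pi_dist _ _ _
  have hp : ∀ a ≤ k, ∀ b ≤ k,
      dist (e (y a) : Fin n → ℝ) (e (y b)) = |(a : ℝ) - b| * lam i₀ := by
    intro a ha b hb
    rw [← hdist a ha b hb, ← e.dist_eq, Subtype.dist_eq]
  have hlt := not_progression_of_avoids_residue hk (hlam i₀)
    (fun a => (e (y a) : Fin n → ℝ)) (T col)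
    (fun a _ j => by
      have := hf (e (y a)) j
      rwa [hcol _ (e (y a)).2] at this)
    (fun a ha => by
      rw [hp a (by omega) (a + 1) (by omega)]
      simp)
  rw [hp k le_rfl 0 (Nat.zero_le k)] at hlt
  simp at hlt

/-! ### Passage to `n`-th roots and conclusion -/

theorem tendsto_natCast_add_one_rpow_div (a : ℝ) :
    Filter.Tendsto (fun n : ℕ => ((n : ℝ) + 1) ^ (a / n)) Filter.atTop (nhds 1) := by
  have h := (tendsto_rpow_div_mul_add a 1 (-1) one_ne_zero.symm).comp
    (Filter.tendsto_atTop_add_const_right Filter.atTop (1 : ℝ)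
      (tendsto_natCast_atTop_atTop (R := ℝ)))
  refine h.congr fun n => ?_
  simp

/-- A sequence which is `r ^ n` up to polynomial factors has `n`-th roots tending to `r`. -/
theorem tendsto_rpow_inv_of_poly_bounds {r : ℝ} (hr : 0 < r) (c : ℕ → ℝ) (d e : ℕ)
    (hlow : ∀ n, r ^ n ≤ c n * ((n : ℝ) + 1) ^ d) (hupp : ∀ n, c n ≤ r ^ n * ((n : ℝ) + 1) ^ e) :
    Filter.Tendsto (fun n : ℕ => c n ^ (n : ℝ)⁻¹) Filter.atTop (nhds r) := by
  have hroot : ∀ (n : ℕ) (a : ℝ), n ≠ 0 →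
      (r ^ n * ((n : ℝ) + 1) ^ a) ^ (n : ℝ)⁻¹ = r * ((n : ℝ) + 1) ^ (a / n) := by
    intro n a hn
    rw [Real.mul_rpow (by positivity) (by positivity), Real.pow_rpow_inv_natCast hr.le hn,
      ← Real.rpow_mul (by positivity), div_eq_mul_inv]
  have hlim : ∀ a : ℝ, Filter.Tendsto (fun n : ℕ => r * ((n : ℝ) + 1) ^ (a / n))
      Filter.atTop (nhds r) := by
    intro a
    simpa using (tendsto_natCast_add_one_rpow_div a).const_mul r
  have hlow' : ∀ n : ℕ, r ^ n * ((n : ℝ) + 1) ^ (-(d : ℝ)) ≤ c n := by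
    intro n
    rw [Real.rpow_neg (by positivity), Real.rpow_natCast, ← div_eq_mul_inv,
      div_le_iff₀ (by positivity)]
    exact hlow n
  refine tendsto_of_tendsto_of_tendsto_of_le_of_le' (hlim (-(d : ℝ))) (hlim (e : ℝ)) ?_ ?_
  · filter_upwards [Filter.eventually_ne_atTop 0] with n hn
    rw [← hroot n _ hn]
    exact Real.rpow_le_rpow (by positivity) (hlow' n) (by positivity)
  · filter_upwards [Filter.eventually_ne_atTop 0] with n hn
    rw [← hroot n _ hn]
    refine Real.rpow_le_rpow (le_trans (by positivity) (hlow' n)) ?_ (by positivity)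
    rw [Real.rpow_natCast]
    exact hupp n

theorem chromaticNumber_le_of_colouring {X Y : Type*} [MetricSpace X] [MetricSpace Y] {s : ℕ}
    (h : ∃ f : X → Fin s, IsProperColouring Y f) : chromaticNumber X Y ≤ s :=
  iInf₂_le s h

theorem exists_colouring_toNat_chromaticNumber {X Y : Type*} [MetricSpace X] [MetricSpace Y]
    (h : chromaticNumber X Y ≠ ⊤) :
    ∃ f : X → Fin (chromaticNumber X Y).toNat, IsProperColouring Y f := by
  by_contra hno
  set N := (chromaticNumber X Y).toNat with hN
  have hcoe : (N : ℕ∞) = chromaticNumber X Y := ENat.natCast_toNat h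
  have hle : ((N + 1 : ℕ) : ℕ∞) ≤ chromaticNumber X Y := by
    refine le_iInf₂ fun c hc => ?_
    have h1 : (N : ℕ∞) ≤ c := hcoe ▸ chromaticNumber_le_of_colouring hc
    have h2 : N ≤ c := by exact_mod_cast h1
    have h3 : N ≠ c := fun h => hno (h ▸ hc)
    exact_mod_cast (show N + 1 ≤ c by omega)
  rw [← hcoe] at hle
  have : N + 1 ≤ N := by exact_mod_cast hle
  omega

theorem theorem5 (k m : ℕ) (hk : 1 ≤ k) (hm : 1 ≤ m) (lam : Fin m → ℝ) (hlam : ∀ i, 0 < lam i) :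
    (∀ n : ℕ, chromaticNumber (Fin n → ℝ) ((i : Fin m) → arithBaton k (lam i)) ≠ ⊤) ∧
      ∃ o : ℕ → ℝ, Filter.Tendsto o Filter.atTop (nhds 0) ∧
        ∀ n : ℕ,
          ((chromaticNumber (Fin n → ℝ) ((i : Fin m) → arithBaton k (lam i))).toNat : ℝ) =
            (((k : ℝ) + 1) / k + o n) ^ n := by
  have hfin : ∀ n : ℕ,
      chromaticNumber (Fin n → ℝ) ((i : Fin m) → arithBaton k (lam i)) ≠ ⊤ := by
    intro n
    obtain ⟨s, -, hs⟩ := exists_isProperColouring hk hm hlam n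
    exact ne_top_of_le_ne_top (ENat.natCast_ne_top s) (chromaticNumber_le_of_colouring hs)
  refine ⟨hfin, ?_⟩
  set χ : ℕ → ℕ := fun n =>
    (chromaticNumber (Fin n → ℝ) ((i : Fin m) → arithBaton k (lam i))).toNat with hχ
  have hk0 : (0 : ℝ) < k := by exact_mod_cast hk
  set r : ℝ := ((k : ℝ) + 1) / k with hr
  have hr0 : 0 < r := by positivity
  have hupp : ∀ n, (χ n : ℝ) ≤ r ^ n * ((n : ℝ) + 1) ^ k := by
    intro n
    obtain ⟨s, hs, hcol⟩ := exists_isProperColouring hk hm hlam n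
    refine le_trans ?_ hs
    exact_mod_cast ENat.toNat_le_of_le_natCast (chromaticNumber_le_of_colouring hcol)
  have hlow : ∀ n, r ^ n ≤ (χ n : ℝ) * ((n : ℝ) + 1) ^ m := by
    intro n
    obtain ⟨f, hf⟩ := exists_colouring_toNat_chromaticNumber (hfin n)
    have h := pow_le_mul_of_isProperColouring hk hm hlam hf
    have h' : ((k : ℝ) + 1) ^ n ≤ χ n * ((k : ℝ) ^ n * ((n : ℝ) + 1) ^ m) := by exact_mod_cast h
    rw [hr, div_pow, div_le_iff₀ (by positivity)]
    linarith
  refine ⟨fun n => (χ n : ℝ) ^ (n : ℝ)⁻¹ - r, ?_, fun n => ?_⟩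
  · simpa using (tendsto_rpow_inv_of_poly_bounds hr0 (fun n => (χ n : ℝ)) m k hlow hupp).sub_const r
  · change (χ n : ℝ) = _
    -- There is no root to take at `n = 0`; there the two bounds force the value `1`.
    rcases eq_or_ne n 0 with rfl | hn
    · have h1 := hupp 0
      have h2 := hlow 0
      simp only [pow_zero, Nat.cast_zero, zero_add, one_pow, mul_one] at h1 h2 ⊢
      exact le_antisymm h1 h2
    · rw [add_sub_cancel, Real.rpow_inv_natCast_pow (Nat.cast_nonneg _) hn]
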